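/- Let $k\ge 3$ be an integer and $\varepsilon>0$. A set $E\subset\mathbb R$ is said to $\varepsilon$-avoid $k$-term progressions if $$\sup_{p\in P}\inf_{x\in E}|x-p|\ \ge\ \varepsilon\lambda$$ for every $\lambda>0$ and every $k$-term arithmetic progression $P=\{a,a+\lambda,\dots,a+(k-1)\lambda\}\subset\mathbb R$ of gap $\lambda$ (with $\inf\varnothing=+\infty$, so that the empty set is allowed; it has dimension $0$ in every sense). Put $$d(k,\varepsilon)=\sup\{\dim_H E:\ E\subset\mathbb R\text{ is bounded and }\varepsilon\text{-avoids }k\text{-term progressions}\},$$ where $\dim_H$ is the Hausdorff dimension. For $r>0$ let $N_r(E)$ be the least number of open balls of radius at most $r$ that cover $E$. The Assouad dimension $\dim_A E$ is the infimum of the $\alpha\ge 0$ for which there is $C>0$ such that $N_r(B(x,R)\cap E)\le C(R/r)^\alpha$ for all $0<r<R$ and $x\in E$. The lower and upper box dimensions $\underline{\dim}_B E$ and $\overline{\dim}_B E$ of a bounded set are the lower and upper limits of $\log N_r(E)/\log(1/r)$ as $r\to0^+$. The packing dimension $\dim_P E$ is the infimum of $\sup_i\overline{\dim}_B E_i$ over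 all countable covers $E\subset\bigcup_i E_i$ by bounded sets $E_i$. Then $$d(k,\varepsilon)=\sup\{\dim_H E:\ E\subset\mathbb R\ \ \varepsilon\text{-avoids }k\text{-term progressions}\},$$ where $E$ need not be bounded, and $$d(k,\varepsilon)=\sup\{\dim E:\ E\subset\mathbb R\text{ is bounded and }\varepsilon\text{-avoids }k\text{-term progressions}\}$$ when $\dim$ is any one of $\dim_A$, $\underline{\dim}_B$, $\overline{\dim}_B$, $\dim_P$. Moreover, these suprema are attained: there is a compact set $E\subset\mathbb R$, non-empty if $\varepsilon<1$, that $\varepsilon$-avoids $k$-term progressions and satisfies $$\dim_H E=\dim_A E=\underline{\dim}_B E=\overline{\dim}_B E=\dim_P E=d(k,\varepsilon).$$ -/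

import Mathlib

open Set Filter Topology
open scoped ENNReal NNReal

noncomputable section

/-- `P` is a `k`-term arithmetic progression of real numbers with gap length `gap > 0`. -/
def IsAP (k : ℕ) (gap : ℝ) (P : Set ℝ) : Prop :=
  0 < gap ∧ ∃ a : ℝ, P = {p | ∃ i : ℕ, i < k ∧ p = a + i * gap}

/-- `E` `ε`-avoids `k`-term progressions: for every `k`-term progression `P` of gap `gap`,
`sup_{p ∈ P} inf_{x ∈ E} |x - p| ≥ ε * gap`. The infimum over `E = ∅` is `+∞`, so that the
empty set avoids all progressions. -/
def AvoidsAPs (k : ℕ) (ε : ℝ) (E : Set ℝ) : Prop :=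
  ∀ (gap : ℝ) (P : Set ℝ), IsAP k gap P →
    ENNReal.ofReal (ε * gap) ≤ ⨆ p ∈ P, ⨅ x ∈ E, ENNReal.ofReal |x - p|

/-- `N_r(E)`: the least number of open balls of radius at most `r` that cover `E`. -/
def coverNum (r : ℝ) (E : Set ℝ) : ℕ∞ :=
  ⨅ (U : Set (Set ℝ)) (_ : ∀ B ∈ U, ∃ x s : ℝ, s ≤ r ∧ B = Metric.ball x s)
    (_ : E ⊆ ⋃₀ U), U.encard

/-- The Assouad dimension. -/
def assouadDim (E : Set ℝ) : ℝ≥0∞ :=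
  ⨅ (α : ℝ≥0) (_ : ∃ C : ℝ, 0 < C ∧ ∀ r R : ℝ, 0 < r → r < R → ∀ x ∈ E,
    (coverNum r (Metric.ball x R ∩ E) : ℝ≥0∞) ≤ ENNReal.ofReal (C * (R / r) ^ (α : ℝ))),
    (α : ℝ≥0∞)

/-- `log N_r(E) / log (1 / r)`; for `E = ∅` the value `-∞` is replaced by `0`, so that the empty
set has dimension `0`. -/
def boxRatio (E : Set ℝ) (r : ℝ) : ℝ≥0∞ :=
  (ENNReal.log (coverNum r E : ℝ≥0∞) / ((-Real.log r : ℝ) : EReal)).toENNReal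

/-- The lower box (Minkowski) dimension. -/
def lowerBoxDim (E : Set ℝ) : ℝ≥0∞ := liminf (boxRatio E) (𝓝[>] (0 : ℝ))

/-- The upper box (Minkowski) dimension. -/
def upperBoxDim (E : Set ℝ) : ℝ≥0∞ := limsup (boxRatio E) (𝓝[>] (0 : ℝ))

/-- The packing dimension: the infimum, over all countable covers of `E` by bounded sets, of the
supremum of the upper box dimensions of the pieces. -/
def packingDim (E : Set ℝ) : ℝ≥0∞ :=
  ⨅ (F : ℕ → Set ℝ) (_ : ∀ i, Bornology.IsBounded (F i)) (_ : E ⊆ ⋃ i, F i),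
    ⨆ i, upperBoxDim (F i)

/-- `d(k, ε)`: the supremum of the Hausdorff dimensions of the bounded sets that `ε`-avoid
`k`-term progressions. -/
def dimAvoid (k : ℕ) (ε : ℝ) : ℝ≥0∞ :=
  ⨆ (E : Set ℝ) (_ : Bornology.IsBounded E ∧ AvoidsAPs k ε E), dimH E

end

/-! ### Sets avoiding progressions -/

/-! Avoidance passes to subsets, closures and similar copies, and the compact avoiding subsets of
`[0, 1]` form a compact family. Fix `s > 0`. If some member of this family has no finite cover by
open intervals with `s`-sum at most `1/2`, its Hausdorff dimension is at least `s`. Otherwise each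
member has such a cover, which also covers all nearby members, so compactness bounds the interval
lengths below uniformly. Rescaling and iterating these covers bounds covering numbers at all scales,
and the slack between `1/2` and `1` pushes every Assouad dimension below some `s' < s`. This
dichotomy is `exists_le_dimH_or_assouadDim_le`.

For `s > d(k, ε)` the first case is impossible, so Assouad dimensions are at most `d(k, ε)`. For `s
= d(k, ε) > 0` the second case is impossible, so the supremum is attained. On bounded sets the other
dimensions lie between Hausdorff and Assouad. -/

theorem avoidsAPs_iff {k : ℕ} {ε : ℝ} (hε : 0 < ε) {E : Set ℝ} :
    AvoidsAPs k ε E ↔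
      ∀ a gap : ℝ, 0 < gap → ∃ i < k, ∀ x ∈ E, ε * gap ≤ |x - (a + i * gap)| := by
  constructor
  · intro h a gap hgap
    by_contra! hcon
    have h1 := h gap _ ⟨hgap, a, rfl⟩
    have hpos : 0 < ENNReal.ofReal (ε * gap) := ENNReal.ofReal_pos.2 (by positivity)
    have hle : (⨆ p ∈ {p | ∃ i : ℕ, i < k ∧ p = a + i * gap}, ⨅ x ∈ E, ENNReal.ofReal |x - p|) ≤
        (Finset.range k).sup fun i : ℕ => ⨅ x ∈ E, ENNReal.ofReal |x - (a + i * gap)| := by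
      refine iSup₂_le ?_
      rintro p ⟨i, hi, rfl⟩
      exact Finset.le_sup (f := fun i : ℕ => ⨅ x ∈ E, ENNReal.ofReal |x - (a + i * gap)|)
        (Finset.mem_range.2 hi)
    refine absurd (h1.trans hle) (not_le.2 ((Finset.sup_lt_iff hpos).2 fun i hi => ?_))
    obtain ⟨x, hx, hlt⟩ := hcon i (Finset.mem_range.1 hi)
    exact (iInf₂_le x hx).trans_lt ((ENNReal.ofReal_lt_ofReal_iff (by positivity)).2 hlt)
  · rintro h gap P ⟨hgap, a, rfl⟩
    obtain ⟨i, hi, hx⟩ := h a gap hgap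
    exact le_iSup₂_of_le (a + i * gap) ⟨i, hi, rfl⟩
      (le_iInf₂ fun x hxE => ENNReal.ofReal_le_ofReal (hx x hxE))

theorem AvoidsAPs.mono {k : ℕ} {ε : ℝ} {E F : Set ℝ} (hF : AvoidsAPs k ε F) (h : E ⊆ F) :
    AvoidsAPs k ε E := fun gap P hP =>
  (hF gap P hP).trans (iSup₂_mono fun _ _ => biInf_mono h)

theorem AvoidsAPs.closure {k : ℕ} {ε : ℝ} (hε : 0 < ε) {E : Set ℝ} (h : AvoidsAPs k ε E) :
    AvoidsAPs k ε (closure E) := by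
  rw [avoidsAPs_iff hε] at h ⊢
  intro a gap hgap
  obtain ⟨i, hi, hx⟩ := h a gap hgap
  have hcl : IsClosed {x : ℝ | ε * gap ≤ |x - (a + i * gap)|} :=
    isClosed_le continuous_const (by fun_prop)
  exact ⟨i, hi, fun x hxE => closure_minimal (fun y hy => hx y hy) hcl hxE⟩

/-- The avoidance property is invariant under increasing similarities. -/
theorem AvoidsAPs.preimage_affine {k : ℕ} {ε : ℝ} (hε : 0 < ε) {E : Set ℝ}
    (h : AvoidsAPs k ε E) (b : ℝ) {R : ℝ} (hR : 0 < R) :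
    AvoidsAPs k ε ((fun x => b + R * x) ⁻¹' E) := by
  rw [avoidsAPs_iff hε] at h ⊢
  intro a gap hgap
  obtain ⟨i, hi, hx⟩ := h (b + R * a) (R * gap) (by positivity)
  refine ⟨i, hi, fun x hxE => ?_⟩
  have h1 := hx _ hxE
  have h2 : b + R * x - (b + R * a + i * (R * gap)) = R * (x - (a + i * gap)) := by ring
  rw [h2, abs_mul, abs_of_pos hR] at h1
  refine le_of_mul_le_mul_left ?_ hR
  linarith

theorem avoidsAPs_empty (k : ℕ) (ε : ℝ) (hk : 3 ≤ k) : AvoidsAPs k ε ∅ := by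
  rintro gap P ⟨hgap, a, rfl⟩
  exact le_iSup₂_of_le (a + (0 : ℕ) * gap) ⟨0, by omega, rfl⟩ (by simp)

theorem avoidsAPs_singleton {k : ℕ} (hk : 3 ≤ k) {ε : ℝ} (hε : 0 < ε) (hε1 : ε < 1) :
    AvoidsAPs k ε {0} := by
  rw [avoidsAPs_iff hε]
  intro a gap hgap
  by_contra! hcon
  obtain ⟨x, hx, h0⟩ := hcon 0 (by omega)
  obtain ⟨y, hy, h2⟩ := hcon 2 (by omega)
  rw [mem_singleton_iff] at hx hy
  subst hx hy
  have h3 : ε * gap < gap := by nlinarith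
  rw [abs_lt] at h0 h2
  push_cast at h0 h2
  linarith [h0.1, h0.2, h2.1, h2.2]

/-- Avoidance is a closed condition on compact sets. -/
theorem isClosed_setOf_avoidsAPs {k : ℕ} {ε : ℝ} (hε : 0 < ε) :
    IsClosed {K : TopologicalSpace.Compacts ℝ | AvoidsAPs k ε (K : Set ℝ)} := by
  -- The term kept away from `K` is one of only `k` candidates, so the existential is a finite union
  -- of closed conditions.
  have : {K : TopologicalSpace.Compacts ℝ | AvoidsAPs k ε (K : Set ℝ)} =
      ⋂ (a : ℝ) (gap : ℝ) (_ : 0 < gap), ⋃ i ∈ Finset.range k,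
        {K : TopologicalSpace.Compacts ℝ |
          (K : Set ℝ) ⊆ {x : ℝ | ε * gap ≤ |x - (a + i * gap)|}} := by
    ext K
    simp only [mem_ofPred_eq, avoidsAPs_iff hε, mem_iInter, mem_iUnion, Finset.mem_range,
      exists_prop]
    rfl
  rw [this]
  refine isClosed_iInter fun a => isClosed_iInter fun gap => isClosed_iInter fun _ => ?_
  refine isClosed_biUnion_finset fun i _ => ?_
  exact TopologicalSpace.Compacts.isClosed_subsets_of_isClosed
    (isClosed_le continuous_const (by fun_prop))

/-! ### Covering numbers -/

theorem exists_cover_encard_eq_coverNum {r : ℝ} (hr : 0 < r) (E : Set ℝ) :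
    ∃ U : Set (Set ℝ), (∀ B ∈ U, ∃ x s : ℝ, s ≤ r ∧ B = Metric.ball x s) ∧ E ⊆ ⋃₀ U ∧
      U.encard = coverNum r E := by
  let T := {U : Set (Set ℝ) // (∀ B ∈ U, ∃ x s : ℝ, s ≤ r ∧ B = Metric.ball x s) ∧ E ⊆ ⋃₀ U}
  have : Nonempty T := by
    refine ⟨⟨range fun x => Metric.ball x r, ?_, fun x _ => ?_⟩⟩
    · rintro _ ⟨x, rfl⟩
      exact ⟨x, r, le_rfl, rfl⟩
    · exact ⟨_, ⟨x, rfl⟩, Metric.mem_ball_self hr⟩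
  obtain ⟨U, hU⟩ := ENat.exists_eq_iInf fun U : T => U.1.encard
  refine ⟨U.1, U.2.1, U.2.2, hU.trans (le_antisymm ?_ ?_)⟩
  · exact le_iInf fun V => le_iInf fun h1 => le_iInf fun h2 =>
      iInf_le (fun U : T => U.1.encard) ⟨V, h1, h2⟩
  · exact le_iInf fun V => iInf_le_of_le V.1 (iInf_le_of_le V.2.1 (iInf_le_of_le V.2.2 le_rfl))

theorem coverNum_le {r : ℝ} {E : Set ℝ} {U : Set (Set ℝ)}
    (hU : ∀ B ∈ U, ∃ x s : ℝ, s ≤ r ∧ B = Metric.ball x s) (hE : E ⊆ ⋃₀ U) :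
    coverNum r E ≤ U.encard :=
  iInf_le_of_le U (iInf_le_of_le hU (iInf_le_of_le hE le_rfl))

theorem coverNum_mono {r : ℝ} {E F : Set ℝ} (h : E ⊆ F) : coverNum r E ≤ coverNum r F :=
  le_iInf fun _ => le_iInf fun h1 => le_iInf fun h2 => coverNum_le h1 (h.trans h2)

theorem coverNum_empty (r : ℝ) : coverNum r ∅ = 0 :=
  le_antisymm ((coverNum_le (U := ∅) (by simp) (empty_subset _)).trans (by simp)) (zero_le)

theorem coverNum_union_le {r : ℝ} (hr : 0 < r) (E F : Set ℝ) :
    coverNum r (E ∪ F) ≤ coverNum r E + coverNum r F := by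
  obtain ⟨U, hU, hEU, hUe⟩ := exists_cover_encard_eq_coverNum hr E
  obtain ⟨V, hV, hFV, hVe⟩ := exists_cover_encard_eq_coverNum hr F
  rw [← hUe, ← hVe]
  refine (coverNum_le (U := U ∪ V) ?_ ?_).trans (encard_union_le U V)
  · rintro B (hB | hB)
    exacts [hU B hB, hV B hB]
  · rw [sUnion_union]
    exact union_subset_union hEU hFV

theorem coverNum_biUnion_le {r : ℝ} (hr : 0 < r) {ι : Type*} (t : Finset ι) (E : ι → Set ℝ) :
    coverNum r (⋃ i ∈ t, E i) ≤ ∑ i ∈ t, coverNum r (E i) := by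
  classical
  induction t using Finset.induction_on with
  | empty => simp [coverNum_empty]
  | insert i t hi ih =>
    rw [Finset.set_biUnion_insert, Finset.sum_insert hi]
    exact (coverNum_union_le hr _ _).trans (by gcongr)

theorem coverNum_le_one {r R a : ℝ} {E : Set ℝ} (hr : 0 < r) (hR : R ≤ r)
    (hE : E ⊆ Icc a (a + R)) : coverNum r E ≤ 1 := by
  refine (coverNum_le (U := {Metric.ball (a + R / 2) r}) ?_ ?_).trans (by simp)
  · rintro B rfl
    exact ⟨_, r, le_rfl, rfl⟩
  · intro x hx
    have := hE hx
    rw [sUnion_singleton, Metric.mem_ball, Real.dist_eq, abs_lt]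
    constructor <;> linarith [this.1, this.2]

/-! ### Comparison of dimensions -/

/-- Truncating negative values to `0` does not affect comparison with `β ≥ 0`, so box dimension
estimates become power bounds. -/
theorem boxRatio_le_iff {E : Set ℝ} {r : ℝ} (hr : 0 < r) (hr1 : r < 1) (β : ℝ≥0) :
    boxRatio E r ≤ β ↔ (coverNum r E : ℝ≥0∞) ≤ ENNReal.ofReal (r ^ (-(β : ℝ))) := by
  have hlog : 0 < -Real.log r := neg_pos.2 (Real.log_neg hr hr1)
  have h1 : ∀ x : EReal, x.toENNReal ≤ (β : ℝ≥0∞) ↔ x ≤ ((β : ℝ) : EReal) := by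
    intro x
    constructor
    · intro h
      have h2 := EReal.coe_ennreal_le_coe_ennreal_iff.2 h
      rw [EReal.coe_toENNReal_eq_max] at h2
      exact (le_max_right _ _).trans h2
    · intro h
      exact (EReal.toENNReal_le_toENNReal h).trans (by simp)
  rw [boxRatio, h1, EReal.div_le_iff_le_mul (by exact_mod_cast hlog) (EReal.coe_ne_top _),
    ← EReal.coe_mul, ← ENNReal.log_le_log_iff, ENNReal.log_ofReal_of_pos (by positivity),
    Real.log_rpow hr]
  congr! 2
  ring

theorem lowerBoxDim_le_upperBoxDim (E : Set ℝ) : lowerBoxDim E ≤ upperBoxDim E :=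
  liminf_le_limsup

theorem packingDim_le_upperBoxDim {E : Set ℝ} (hE : Bornology.IsBounded E) :
    packingDim E ≤ upperBoxDim E :=
  iInf_le_of_le (fun _ => E) (iInf_le_of_le (fun _ => hE)
    (iInf_le_of_le (subset_iUnion (fun _ : ℕ => E) 0) (by simp)))

theorem upperBoxDim_le_assouadDim {E : Set ℝ} (hE : Bornology.IsBounded E) :
    upperBoxDim E ≤ assouadDim E := by
  refine le_iInf fun α => le_iInf ?_
  rintro ⟨C, hC, hα⟩
  refine ENNReal.le_of_forall_pos_le_add fun η hη _ => ?_
  rw [← ENNReal.coe_add]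
  refine limsup_le_of_le (by isBoundedDefault) ?_
  rcases E.eq_empty_or_nonempty with rfl | ⟨x, hx⟩
  · have h1 : ∀ᶠ r : ℝ in 𝓝[>] (0 : ℝ), r ∈ Ioo (0 : ℝ) 1 := Ioo_mem_nhdsGT one_pos
    filter_upwards [h1] with r hr
    rw [boxRatio_le_iff hr.1 hr.2, coverNum_empty]
    simp
  obtain ⟨R, hRpos, hR⟩ := hE.subset_ball_lt 0 x
  have hA : 0 < C * R ^ (α : ℝ) := by positivity
  have h1 : ∀ᶠ r : ℝ in 𝓝[>] (0 : ℝ), r ∈ Ioo (0 : ℝ) (min 1 R) :=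
    Ioo_mem_nhdsGT (lt_min one_pos hRpos)
  -- The extra exponent `η` absorbs the constant `C * R ^ α` at small scales.
  have h2 : ∀ᶠ r : ℝ in 𝓝[>] (0 : ℝ), r ^ (η : ℝ) < (C * R ^ (α : ℝ))⁻¹ := by
    have hc : Tendsto (fun r : ℝ => r ^ (η : ℝ)) (𝓝[>] 0) (𝓝 (0 ^ (η : ℝ))) :=
      ((Real.continuous_rpow_const η.2).tendsto 0).mono_left nhdsWithin_le_nhds
    rw [Real.zero_rpow (by exact_mod_cast hη.ne')] at hc
    exact hc.eventually_lt_const (by positivity)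
  filter_upwards [h1, h2] with r hr hr2
  have hr0 : 0 < r := hr.1
  rw [boxRatio_le_iff hr0 (hr.2.trans_le (min_le_left _ _))]
  have h3 := hα r R hr0 (hr.2.trans_le (min_le_right _ _)) x hx
  rw [inter_eq_self_of_subset_right hR] at h3
  refine h3.trans (ENNReal.ofReal_le_ofReal ?_)
  rw [Real.div_rpow hRpos.le hr0.le, NNReal.coe_add, neg_add, Real.rpow_add hr0,
    Real.rpow_neg hr0.le, Real.rpow_neg hr0.le]
  have h4 : C * R ^ (α : ℝ) ≤ (r ^ (η : ℝ))⁻¹ := by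
    rw [le_inv_comm₀ hA (by positivity)]
    exact hr2.le
  calc C * (R ^ (α : ℝ) / r ^ (α : ℝ)) = (r ^ (α : ℝ))⁻¹ * (C * R ^ (α : ℝ)) := by ring
    _ ≤ _ := by gcongr

theorem dimH_le_lowerBoxDim (E : Set ℝ) : dimH E ≤ lowerBoxDim E := by
  refine le_of_forall_gt_imp_ge_of_dense fun s' hs' => ?_
  obtain ⟨s, hs, hss'⟩ := ENNReal.lt_iff_exists_nnreal_btwn.1 hs'
  refine le_trans ?_ hss'.le
  have hfreq : ∃ᶠ r in 𝓝[>] (0 : ℝ), boxRatio E r < s :=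
    frequently_lt_of_liminf_lt (by isBoundedDefault) hs
  have h1 : ∀ᶠ r : ℝ in 𝓝[>] (0 : ℝ), r ∈ Ioo (0 : ℝ) 1 := Ioo_mem_nhdsGT one_pos
  obtain ⟨r, hr0, hr⟩ := exists_seq_forall_of_frequently (hfreq.and_eventually h1)
  have hcov : ∀ n, (coverNum (r n) E : ℝ≥0∞) ≤ ENNReal.ofReal (r n ^ (-(s : ℝ))) := fun n =>
    (boxRatio_le_iff (hr n).2.1 (hr n).2.2 s).1 (hr n).1.le
  choose U hUb hUE hUc using fun n => exists_cover_encard_eq_coverNum (hr n).2.1 E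
  have hfin : ∀ n, (U n).Finite := fun n => by
    rw [← encard_lt_top_iff, hUc]
    have := (hcov n).trans_lt ENNReal.ofReal_lt_top
    exact_mod_cast this
  have hfin' : ∀ n, Fintype (U n) := fun n => (hfin n).fintype
  have hd : ∀ n (i : U n), Metric.ediam (i : Set ℝ) ≤ ENNReal.ofReal (2 * r n) := by
    rintro n ⟨B, hB⟩
    obtain ⟨x, t, ht, rfl⟩ := hUb n B hB
    simp only [Real.ball_eq_Ioo, Real.ediam_Ioo]
    exact ENNReal.ofReal_le_ofReal (by linarith)
  have hlim : Tendsto (fun n => ENNReal.ofReal (2 * r n)) atTop (𝓝 0) := by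
    have h2 : Tendsto r atTop (𝓝 0) := hr0.mono_right nhdsWithin_le_nhds
    have h3 := ENNReal.tendsto_ofReal (h2.const_mul 2)
    simpa using h3
  -- Along the scales `r n → 0`, the `s`-sum is at most `r ^ (-s) * (2 * r) ^ s = 2 ^ s`.
  refine dimH_le_of_hausdorffMeasure_ne_top (ne_top_of_le_ne_top
    (ENNReal.ofReal_ne_top (r := 2 ^ (s : ℝ))) ?_)
  refine (MeasureTheory.Measure.hausdorffMeasure_le_liminf_sum (s : ℝ) E _ hlim
    (fun n (i : U n) => (i : Set ℝ)) (Eventually.of_forall hd)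
    (Eventually.of_forall fun n => by rw [← sUnion_eq_iUnion]; exact hUE n)).trans ?_
  refine liminf_le_of_frequently_le' (Frequently.of_forall fun n => ?_)
  have hrn : 0 < r n := (hr n).2.1
  calc ∑ i : U n, Metric.ediam (i : Set ℝ) ^ (s : ℝ)
      ≤ ∑ i : U n, ENNReal.ofReal (2 * r n) ^ (s : ℝ) := by
        gcongr with i
        exact hd n i
    _ = (coverNum (r n) E : ℝ≥0∞) * ENNReal.ofReal ((2 * r n) ^ (s : ℝ)) := by
        rw [Finset.sum_const, nsmul_eq_mul, ENNReal.ofReal_rpow_of_nonneg (by positivity) s.coe_nonneg,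
          ← hUc, ← (hfin n).cast_ncard_eq, Finset.card_univ, fintypeCard_eq_ncard,
          ENat.toENNReal_coe]
    _ ≤ ENNReal.ofReal (r n ^ (-(s : ℝ))) * ENNReal.ofReal ((2 * r n) ^ (s : ℝ)) := by
        gcongr
        exact hcov n
    _ = ENNReal.ofReal (2 ^ (s : ℝ)) := by
        rw [← ENNReal.ofReal_mul (by positivity), Real.mul_rpow (by norm_num) hrn.le,
          Real.rpow_neg hrn.le]
        congr 1
        field_simp

theorem dimH_le_packingDim (E : Set ℝ) : dimH E ≤ packingDim E := by
  refine le_iInf fun F => le_iInf fun _ => le_iInf fun hEF => ?_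
  refine (dimH_mono hEF).trans ?_
  rw [dimH_iUnion]
  exact iSup_mono fun i => (dimH_le_lowerBoxDim _).trans (lowerBoxDim_le_upperBoxDim _)

/-! ### Finite covers by intervals -/

/-- `E` is covered by finitely many open intervals of lengths `ℓ i ≥ δ` with
`∑ i, ℓ i ^ s ≤ c`. -/
def HasIntervalCover (s c δ : ℝ) (E : Set ℝ) : Prop :=
  ∃ (t : Finset ℕ) (a ℓ : ℕ → ℝ), (∀ i ∈ t, δ ≤ ℓ i) ∧
    E ⊆ (⋃ i ∈ t, Ioo (a i) (a i + ℓ i)) ∧ ∑ i ∈ t, ℓ i ^ s ≤ c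

theorem HasIntervalCover.mono {s c δ δ' : ℝ} {E F : Set ℝ} (h : HasIntervalCover s c δ F)
    (hEF : E ⊆ F) (hδ : δ' ≤ δ) : HasIntervalCover s c δ' E := by
  obtain ⟨t, a, ℓ, h1, h2, h3⟩ := h
  exact ⟨t, a, ℓ, fun i hi => hδ.trans (h1 i hi), hEF.trans h2, h3⟩

/-- A set of diameter `≤ 1` lies in an open interval whose length is comparable to its diameter,
up to a given error. -/
theorem exists_Ioo_superset {s : ℝ} (hs : 0 < s) {A : Set ℝ} (hA : Metric.ediam A ≤ 1) {e : ℝ≥0}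
    (he : 0 < e) : ∃ a ℓ : ℝ, 0 < ℓ ∧ A ⊆ Ioo a (a + ℓ) ∧
      ENNReal.ofReal (ℓ ^ s) ≤
        ENNReal.ofReal (4 ^ s) * ((⨆ _ : A.Nonempty, Metric.ediam A ^ s) + e) := by
  have hes : 0 < (e : ℝ) ^ s⁻¹ := Real.rpow_pos_of_pos (by exact_mod_cast he) _
  have hee : ENNReal.ofReal (((e : ℝ) ^ s⁻¹) ^ s) = e := by
    rw [Real.rpow_inv_rpow e.coe_nonneg hs.ne', ENNReal.ofReal_coe_nnreal]
  rcases A.eq_empty_or_nonempty with rfl | hne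
  · refine ⟨0, 4 * (e : ℝ) ^ s⁻¹, by positivity, empty_subset _, ?_⟩
    rw [Real.mul_rpow (by norm_num) hes.le, ENNReal.ofReal_mul (by positivity), hee]
    gcongr
    exact le_add_self
  obtain ⟨x, hx⟩ := hne
  have htop : Metric.ediam A ≠ ⊤ := ne_top_of_le_ne_top ENNReal.one_ne_top hA
  -- The second entry keeps the length positive when `A` is a point; it contributes exactly `e` to
  -- the `s`-sum.
  set m : ℝ := max (Metric.diam A) ((e : ℝ) ^ s⁻¹) with hm
  have hm0 : 0 < m := lt_max_of_lt_right hes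
  refine ⟨x - 2 * m, 4 * m, by positivity, fun y hy => ?_, ?_⟩
  · have h1 : dist y x ≤ Metric.diam A :=
      Metric.dist_le_diam_of_mem (Metric.isBounded_iff_ediam_ne_top.2 htop) hy hx
    have h2 : Metric.diam A ≤ m := le_max_left _ _
    rw [Real.dist_eq, abs_le] at h1
    constructor <;> linarith [h1.1, h1.2]
  · rw [Real.mul_rpow (by norm_num) hm0.le, ENNReal.ofReal_mul (by positivity),
      iSup_pos ⟨x, hx⟩]
    gcongr
    rcases max_choice (Metric.diam A) ((e : ℝ) ^ s⁻¹) with h | h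
    · rw [hm, h, ← ENNReal.ofReal_rpow_of_nonneg Metric.diam_nonneg hs.le, Metric.diam,
        ENNReal.ofReal_toReal htop]
      exact le_self_add
    · rw [hm, h, hee]
      exact le_add_self

/-- A mass-distribution-type lower bound: if finite covers of the compact set `K` by open
intervals cannot have small `s`-sums, then `dimH K ≥ s`. -/
theorem le_dimH_of_forall_not_hasIntervalCover {K : Set ℝ} (hK : IsCompact K) {s : ℝ≥0}
    (hs : 0 < s) {c : ℝ} (hc : 0 < c) (h : ∀ δ > 0, ¬ HasIntervalCover s c δ K) :
    (s : ℝ≥0∞) ≤ dimH K := by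
  have hs' : (0 : ℝ) < s := by exact_mod_cast hs
  refine le_dimH_of_hausdorffMeasure_ne_zero fun hzero => ?_
  -- Chosen so that `4 ^ s * (c' + c') = c`: one `c'` for the cover, one for the enlargement errors.
  set c' : ℝ := c / (2 * 4 ^ (s : ℝ)) with hc'
  have hc'0 : 0 < c' := by positivity
  rw [MeasureTheory.Measure.hausdorffMeasure_apply] at hzero
  have h1 := (le_iSup₂ (f := fun (r : ℝ≥0∞) (_ : 0 < r) =>
    ⨅ (t : ℕ → Set ℝ) (_ : K ⊆ ⋃ n, t n) (_ : ∀ n, Metric.ediam (t n) ≤ r),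
          ∑' n, ⨆ _ : (t n).Nonempty, Metric.ediam (t n) ^ (s : ℝ)) 1 one_pos).trans_eq hzero
  have h2 := h1.trans_lt (ENNReal.ofReal_pos.2 hc'0)
  simp only [iInf_lt_iff] at h2
  obtain ⟨t, hKt, htd, hsum⟩ := h2
  obtain ⟨e, he, hesum⟩ := ENNReal.exists_pos_sum_of_countable
    (ENNReal.ofReal_pos.2 hc'0).ne' ℕ
  choose a ℓ hℓ hsub hle using fun n => exists_Ioo_superset hs' (htd n) (he n)
  obtain ⟨u, hu⟩ := hK.elim_finite_subcover (fun n => Ioo (a n) (a n + ℓ n))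
    (fun _ => isOpen_Ioo) (hKt.trans (iUnion_mono hsub))
  have hδ : ∃ δ > 0, ∀ i ∈ u, δ ≤ ℓ i := by
    rcases u.eq_empty_or_nonempty with rfl | hne
    · exact ⟨1, one_pos, by simp⟩
    · obtain ⟨j, hj, hmin⟩ := u.exists_min_image ℓ hne
      exact ⟨ℓ j, hℓ j, hmin⟩
  obtain ⟨δ, hδ0, hδ⟩ := hδ
  refine h δ hδ0 ⟨u, a, ℓ, hδ, hu, ?_⟩
  rw [← ENNReal.ofReal_le_ofReal_iff hc.le,
    ENNReal.ofReal_sum_of_nonneg fun i _ => Real.rpow_nonneg (hℓ i).le _]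
  calc ∑ i ∈ u, ENNReal.ofReal (ℓ i ^ (s : ℝ)) ≤ ∑' i, ENNReal.ofReal (ℓ i ^ (s : ℝ)) :=
        ENNReal.sum_le_tsum u
    _ ≤ ∑' i, ENNReal.ofReal (4 ^ (s : ℝ)) *
          ((⨆ _ : (t i).Nonempty, Metric.ediam (t i) ^ (s : ℝ)) + e i) := ENNReal.tsum_le_tsum hle
    _ ≤ ENNReal.ofReal (4 ^ (s : ℝ)) * (ENNReal.ofReal c' + ENNReal.ofReal c') := by
        rw [ENNReal.tsum_mul_left, ENNReal.tsum_add]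
        gcongr
    _ = ENNReal.ofReal c := by
        rw [← ENNReal.ofReal_add hc'0.le hc'0.le, ← ENNReal.ofReal_mul (by positivity), hc']
        congr 1
        field_simp
        norm_num

/-- By compactness of the space of compact subsets of `[0, 1]`, the interval lengths in covers of
avoiding sets can be bounded below uniformly. -/
theorem exists_uniform_hasIntervalCover {k : ℕ} {ε : ℝ} (hε : 0 < ε) {s c : ℝ}
    (h : ∀ K : Set ℝ, IsCompact K → K ⊆ Icc 0 1 → AvoidsAPs k ε K →
      ∃ δ > 0, HasIntervalCover s c δ K) :
    ∃ δ > 0, ∀ E : Set ℝ, E ⊆ Icc 0 1 → AvoidsAPs k ε E → HasIntervalCover s c δ E := by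
  have hS : IsCompact ({K : TopologicalSpace.Compacts ℝ | (K : Set ℝ) ⊆ Icc 0 1} ∩
      {K | AvoidsAPs k ε (K : Set ℝ)}) :=
    (TopologicalSpace.Compacts.isCompact_subsets_of_isCompact isCompact_Icc).inter_right
      (isClosed_setOf_avoidsAPs hε)
  have hunif : ∃ δ > 0, ∀ K ∈ ({K : TopologicalSpace.Compacts ℝ | (K : Set ℝ) ⊆ Icc 0 1} ∩
      {K | AvoidsAPs k ε (K : Set ℝ)}), HasIntervalCover s c δ (K : Set ℝ) := by
    refine hS.induction_on (p := fun S : Set (TopologicalSpace.Compacts ℝ) =>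
      ∃ δ > 0, ∀ K ∈ S, HasIntervalCover s c δ (K : Set ℝ)) ⟨1, one_pos, by simp⟩ ?_ ?_ ?_
    · rintro S T hST ⟨δ, hδ, hT⟩
      exact ⟨δ, hδ, fun K hK => hT K (hST hK)⟩
    · rintro S T ⟨δ, hδ, hS⟩ ⟨δ', hδ', hT⟩
      refine ⟨min δ δ', lt_min hδ hδ', ?_⟩
      rintro K (hK | hK)
      · exact (hS K hK).mono subset_rfl (min_le_left _ _)
      · exact (hT K hK).mono subset_rfl (min_le_right _ _)
    · rintro K ⟨hK1, hK2⟩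
      obtain ⟨δ, hδ, t, a, ℓ, h1, h2, h3⟩ := h K K.isCompact hK1 hK2
      have hopen : IsOpen (⋃ i ∈ t, Ioo (a i) (a i + ℓ i)) :=
        isOpen_biUnion fun _ _ => isOpen_Ioo
      exact ⟨_, mem_nhdsWithin_of_mem_nhds
        ((TopologicalSpace.Compacts.isOpen_subsets_of_isOpen hopen).mem_nhds h2),
        δ, hδ, fun K' hK' => ⟨t, a, ℓ, h1, hK', h3⟩⟩
  obtain ⟨δ, hδ, hδS⟩ := hunif
  refine ⟨δ, hδ, fun E hE hEa => ?_⟩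
  have hcl : closure E ⊆ Icc 0 1 := closure_minimal hE isClosed_Icc
  exact (hδS ⟨closure E, isCompact_Icc.of_isClosed_subset isClosed_closure hcl⟩
    ⟨hcl, hEa.closure hε⟩).mono subset_closure le_rfl

/-! ### The Assouad dimension of avoiding sets -/

/-- Iterating a covering of the avoiding subsets of `[0, 1]` bounds covering numbers of avoiding
sets at all scales. -/
theorem coverNum_le_of_hasIntervalCover {k : ℕ} {ε : ℝ} (hε : 0 < ε) {s δ η : ℝ} (hs : 0 ≤ s)
    (hδ : 0 < δ) (hη : 0 < η)
    (h : ∀ E : Set ℝ, E ⊆ Icc 0 1 → AvoidsAPs k ε E →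
      ∃ (t : Finset ℕ) (a ℓ : ℕ → ℝ), (∀ i ∈ t, δ ≤ ℓ i ∧ ℓ i ≤ η) ∧
        E ⊆ (⋃ i ∈ t, Ioo (a i) (a i + ℓ i)) ∧ ∑ i ∈ t, ℓ i ^ s ≤ 1)
    {r : ℝ} (hr : 0 < r) (n : ℕ) :
    ∀ (E : Set ℝ) (b R : ℝ), AvoidsAPs k ε E → E ⊆ Icc b (b + R) → δ * r ≤ R → R * η ^ n ≤ r →
      (coverNum r E : ℝ≥0∞) ≤ ENNReal.ofReal ((R / (δ * r)) ^ s) := by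
  have hsmall : ∀ (E : Set ℝ) (b R : ℝ), E ⊆ Icc b (b + R) → δ * r ≤ R → R ≤ r →
      (coverNum r E : ℝ≥0∞) ≤ ENNReal.ofReal ((R / (δ * r)) ^ s) := by
    intro E b R hE hR hRr
    have h1 : (coverNum r E : ℝ≥0∞) ≤ 1 := by
      exact_mod_cast coverNum_le_one hr hRr hE
    refine h1.trans ?_
    rw [ENNReal.one_le_ofReal]
    exact Real.one_le_rpow ((one_le_div (by positivity)).2 hR) hs
  induction n with
  | zero =>
    intro E b R _ hE hR hRn
    exact hsmall E b R hE hR (by simpa using hRn)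
  | succ n ih =>
    intro E b R hEa hE hR hRn
    -- If `R ≤ r`, one ball suffices. If `R > r`, each piece has length `R * ℓ i ≥ δ * r`, as the
    -- induction hypothesis needs.
    rcases le_or_gt R r with hRr | hRr
    · exact hsmall E b R hE hR hRr
    have hR0 : 0 < R := hr.trans hRr
    obtain ⟨t, a, ℓ, hℓ, hcov, hsum⟩ := h ((fun x => b + R * x) ⁻¹' E)
      (fun x hx => by
        have := hE hx
        constructor
        · nlinarith [this.1]
        · nlinarith [this.2]) (hEa.preimage_affine hε b hR0)
    let F : ℕ → Set ℝ := fun i => E ∩ Icc (b + R * a i) (b + R * a i + R * ℓ i)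
    have hEF : E ⊆ ⋃ i ∈ t, F i := by
      intro x hx
      have h1 : (x - b) / R ∈ (fun x => b + R * x) ⁻¹' E := by
        have : b + R * ((x - b) / R) = x := by field_simp; ring
        simpa only [mem_preimage, this] using hx
      obtain ⟨i, hi, hxi⟩ := mem_iUnion₂.1 (hcov h1)
      refine mem_iUnion₂.2 ⟨i, hi, hx, ?_⟩
      have h2 := (lt_div_iff₀ hR0).1 hxi.1
      have h3 := (div_lt_iff₀ hR0).1 hxi.2
      constructor <;> nlinarith
    have hF : ∀ i ∈ t, (coverNum r (F i) : ℝ≥0∞) ≤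
        ENNReal.ofReal ((R / (δ * r)) ^ s * ℓ i ^ s) := by
      intro i hi
      obtain ⟨h1, h2⟩ := hℓ i hi
      have hℓ0 : 0 < ℓ i := hδ.trans_le h1
      have h3 := ih (F i) _ (R * ℓ i) (hEa.mono inter_subset_left) inter_subset_right
        (by nlinarith) (by
          refine le_trans ?_ hRn
          rw [pow_succ', ← mul_assoc]
          gcongr)
      rwa [show R * ℓ i / (δ * r) = R / (δ * r) * ℓ i by ring,
        Real.mul_rpow (by positivity) hℓ0.le] at h3
    have hsub : (coverNum r E : ℝ≥0∞) ≤ ∑ i ∈ t, (coverNum r (F i) : ℝ≥0∞) := by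
      have := (coverNum_mono (r := r) hEF).trans (coverNum_biUnion_le hr t F)
      calc (coverNum r E : ℝ≥0∞) ≤ ((∑ i ∈ t, coverNum r (F i) : ℕ∞) : ℝ≥0∞) := by
            exact_mod_cast this
        _ = _ := map_sum ENat.toENNRealRingHom _ _
    calc (coverNum r E : ℝ≥0∞) ≤ ∑ i ∈ t, (coverNum r (F i) : ℝ≥0∞) := hsub
      _ ≤ ∑ i ∈ t, ENNReal.ofReal ((R / (δ * r)) ^ s * ℓ i ^ s) := Finset.sum_le_sum hF
      _ = ENNReal.ofReal ((R / (δ * r)) ^ s * ∑ i ∈ t, ℓ i ^ s) := by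
          rw [Finset.mul_sum, ENNReal.ofReal_sum_of_nonneg]
          intro i hi
          have := hδ.trans_le (hℓ i hi).1
          positivity
      _ ≤ ENNReal.ofReal ((R / (δ * r)) ^ s) :=
          ENNReal.ofReal_le_ofReal (mul_le_of_le_one_right (by positivity) hsum)

/-- The number of iterations does not enter the covering bound. A ball of radius `R` lies in an
interval of length `2 * R`, whence the constant `(2 / δ) ^ s`. -/
theorem assouadDim_le_of_hasIntervalCover {k : ℕ} {ε : ℝ} (hε : 0 < ε) {s : ℝ≥0} {δ η : ℝ}
    (hδ : 0 < δ) (hδ1 : δ ≤ 1) (hη : 0 < η) (hη1 : η < 1)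
    (h : ∀ E : Set ℝ, E ⊆ Icc 0 1 → AvoidsAPs k ε E →
      ∃ (t : Finset ℕ) (a ℓ : ℕ → ℝ), (∀ i ∈ t, δ ≤ ℓ i ∧ ℓ i ≤ η) ∧
        E ⊆ (⋃ i ∈ t, Ioo (a i) (a i + ℓ i)) ∧ ∑ i ∈ t, ℓ i ^ (s : ℝ) ≤ 1)
    {E : Set ℝ} (hE : AvoidsAPs k ε E) : assouadDim E ≤ s := by
  refine iInf₂_le s ⟨(2 / δ) ^ (s : ℝ), by positivity, fun r R hr hrR x _ => ?_⟩
  have hR : 0 < R := hr.trans hrR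
  obtain ⟨n, hn⟩ := exists_pow_lt_of_lt_one (div_pos hr (mul_pos two_pos hR)) hη1
  have h1 := coverNum_le_of_hasIntervalCover hε s.coe_nonneg hδ hη h hr n
    (Metric.ball x R ∩ E) (x - R) (2 * R) (hE.mono inter_subset_right) (by
      rw [Real.ball_eq_Ioo]
      refine inter_subset_left.trans (Ioo_subset_Icc_self.trans (Icc_subset_Icc le_rfl ?_))
      linarith) (by nlinarith) (by
      rw [lt_div_iff₀ (by positivity)] at hn
      linarith)
  rwa [show 2 * R / (δ * r) = 2 / δ * (R / r) by field_simp,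
    Real.mul_rpow (by positivity) (by positivity)] at h1

/-- For `s > 0`, either some compact avoiding set has Hausdorff dimension at least `s`, or the
Assouad dimensions of all avoiding sets are bounded by some `s' < s`. -/
theorem exists_le_dimH_or_assouadDim_le {k : ℕ} {ε : ℝ} (hε : 0 < ε) {s : ℝ≥0} (hs : 0 < s) :
    (∃ K : Set ℝ, IsCompact K ∧ AvoidsAPs k ε K ∧ (s : ℝ≥0∞) ≤ dimH K) ∨
      ∃ s' < s, ∀ E : Set ℝ, AvoidsAPs k ε E → assouadDim E ≤ s' := by
  have hs0 : (0 : ℝ) < s := by exact_mod_cast hs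
  by_cases hcase : ∃ K : Set ℝ, IsCompact K ∧ K ⊆ Icc 0 1 ∧ AvoidsAPs k ε K ∧
      ∀ δ > 0, ¬ HasIntervalCover s (1 / 2) δ K
  · obtain ⟨K, hK, -, hKa, hcov⟩ := hcase
    exact Or.inl ⟨K, hK, hKa,
      le_dimH_of_forall_not_hasIntervalCover hK hs (by norm_num) hcov⟩
  right
  push Not at hcase
  obtain ⟨δ₀, hδ₀, hcov₀⟩ := exists_uniform_hasIntervalCover hε hcase
  obtain ⟨δ, hδ, hδ1, hcov⟩ : ∃ δ > 0, δ ≤ 1 ∧ ∀ E : Set ℝ, E ⊆ Icc 0 1 → AvoidsAPs k ε E →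
      HasIntervalCover s (1 / 2) δ E :=
    ⟨min δ₀ 1, lt_min hδ₀ one_pos, min_le_right _ _, fun E h1 h2 =>
      (hcov₀ E h1 h2).mono subset_rfl (min_le_left _ _)⟩
  -- As all lengths are at least `δ`, lowering the exponent by `τ` costs a factor below `2`, which
  -- the bound `1 / 2` can afford.
  have hτ : ∀ᶠ τ : ℝ in 𝓝[>] 0, δ ^ (-τ) < 2 := by
    have hc : Continuous fun τ : ℝ => δ ^ (-τ) :=
      Real.continuous_const_rpow hδ.ne' |>.comp continuous_neg
    have := (hc.tendsto 0).mono_left (nhdsWithin_le_nhds (s := Ioi 0))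
    exact this.eventually_lt_const (by simp)
  have hτ' : ∀ᶠ τ : ℝ in 𝓝[>] 0, τ ∈ Ioo 0 (s : ℝ) := Ioo_mem_nhdsGT hs0
  obtain ⟨τ, hτ2, hτ0, hτs⟩ := (hτ.and hτ').exists
  obtain ⟨s', hs'⟩ : ∃ s' : ℝ≥0, (s' : ℝ) = s - τ :=
    ⟨((s : ℝ) - τ).toNNReal, Real.coe_toNNReal _ (by linarith)⟩
  refine ⟨s', ?_, fun E hE => ?_⟩
  · rw [← NNReal.coe_lt_coe]
    linarith
  -- Each single term satisfies `ℓ i ^ s ≤ 1 / 2`, which forces a definite contraction.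
  refine assouadDim_le_of_hasIntervalCover hε hδ hδ1 (η := (1 / 2) ^ (s : ℝ)⁻¹) (by positivity)
    (Real.rpow_lt_one (by norm_num) (by norm_num) (by positivity)) (fun F hF hFa => ?_) hE
  obtain ⟨t, a, ℓ, h1, h2, h3⟩ := hcov F hF hFa
  have hℓ0 : ∀ i ∈ t, 0 < ℓ i := fun i hi => hδ.trans_le (h1 i hi)
  refine ⟨t, a, ℓ, fun i hi => ⟨h1 i hi, ?_⟩, h2, ?_⟩
  · rw [Real.le_rpow_inv_iff_of_pos (hℓ0 i hi).le (by norm_num) hs0]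
    exact (Finset.single_le_sum (f := fun i => ℓ i ^ (s : ℝ))
      (fun j hj => Real.rpow_nonneg (hℓ0 j hj).le _) hi).trans h3
  · rw [hs']
    calc ∑ i ∈ t, ℓ i ^ ((s : ℝ) - τ) ≤ ∑ i ∈ t, ℓ i ^ (s : ℝ) * 2 := by
          refine Finset.sum_le_sum fun i hi => ?_
          rw [sub_eq_add_neg, Real.rpow_add (hℓ0 i hi)]
          have h4 : ℓ i ^ (-τ) ≤ δ ^ (-τ) :=
            Real.rpow_le_rpow_of_nonpos hδ (h1 i hi) (by linarith)
          have := Real.rpow_nonneg (hℓ0 i hi).le (s : ℝ)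
          gcongr
          linarith
      _ = (∑ i ∈ t, ℓ i ^ (s : ℝ)) * 2 := (Finset.sum_mul _ _ _).symm
      _ ≤ 1 := by linarith

theorem dimAvoid_ne_top (k : ℕ) (ε : ℝ) : dimAvoid k ε ≠ ⊤ := by
  refine ne_top_of_le_ne_top ENNReal.one_ne_top (iSup₂_le fun E _ => ?_)
  exact (dimH_mono (subset_univ E)).trans_eq Real.dimH_univ

theorem AvoidsAPs.assouadDim_le {k : ℕ} {ε : ℝ} (hε : 0 < ε) {E : Set ℝ}
    (hE : AvoidsAPs k ε E) : assouadDim E ≤ dimAvoid k ε := by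
  refine le_of_forall_gt_imp_ge_of_dense fun u hu => ?_
  obtain ⟨s, hs, hsu⟩ := ENNReal.lt_iff_exists_nnreal_btwn.1 hu
  refine le_trans ?_ hsu.le
  rcases exists_le_dimH_or_assouadDim_le (k := k) hε
    (ENNReal.coe_pos.1 (bot_le.trans_lt hs)) with ⟨K, hK, hKa, hKs⟩ | ⟨s', hs', h⟩
  · exact absurd (hKs.trans (le_iSup₂_of_le K ⟨hK.isBounded, hKa⟩ le_rfl)) hs.not_ge
  · exact (h E hE).trans (by exact_mod_cast hs'.le)

/-- The supremum of the Hausdorff dimensions is attained by a compact set. -/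
theorem exists_isCompact_dimAvoid_le_dimH {k : ℕ} (hk : 3 ≤ k) {ε : ℝ} (hε : 0 < ε) :
    ∃ K : Set ℝ, IsCompact K ∧ (ε < 1 → K.Nonempty) ∧ AvoidsAPs k ε K ∧
      dimAvoid k ε ≤ dimH K := by
  -- The dichotomy needs `s > 0`, so dimension zero is settled by a point or the empty set.
  rcases eq_or_ne (dimAvoid k ε) 0 with h0 | h0
  · by_cases hε1 : ε < 1
    · exact ⟨{0}, isCompact_singleton, fun _ => singleton_nonempty 0,
        avoidsAPs_singleton hk hε hε1, by simp [h0]⟩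
    · exact ⟨∅, isCompact_empty, fun h => absurd h hε1, avoidsAPs_empty k ε hk, by simp [h0]⟩
  obtain ⟨s, hs⟩ : ∃ s : ℝ≥0, (s : ℝ≥0∞) = dimAvoid k ε :=
    ⟨_, ENNReal.coe_toNNReal (dimAvoid_ne_top k ε)⟩
  have hs0 : 0 < s := by
    rw [← hs] at h0
    exact pos_iff_ne_zero.2 (by simpa using h0)
  rcases exists_le_dimH_or_assouadDim_le (k := k) hε hs0 with ⟨K, hK, hKa, hKs⟩ | ⟨s', hs', h⟩
  · refine ⟨K, hK, fun _ => ?_, hKa, hs ▸ hKs⟩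
    by_contra hne
    rw [not_nonempty_iff_eq_empty] at hne
    rw [hne, dimH_empty] at hKs
    exact hs0.ne' (by simpa using hKs)
  · have hle : dimAvoid k ε ≤ s' := iSup₂_le fun E hE =>
      (dimH_le_lowerBoxDim E).trans ((lowerBoxDim_le_upperBoxDim E).trans
        ((upperBoxDim_le_assouadDim hE.1).trans (h E hE.2)))
    rw [← hs] at hle
    exact absurd (ENNReal.coe_le_coe.1 hle) hs'.not_ge

theorem corollary2p5 (k : ℕ) (hk : 3 ≤ k) (ε : ℝ) (hε : 0 < ε) :
    dimAvoid k ε = (⨆ (E : Set ℝ) (_ : AvoidsAPs k ε E), dimH E) ∧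
    dimAvoid k ε =
      (⨆ (E : Set ℝ) (_ : Bornology.IsBounded E ∧ AvoidsAPs k ε E), assouadDim E) ∧
    dimAvoid k ε =
      (⨆ (E : Set ℝ) (_ : Bornology.IsBounded E ∧ AvoidsAPs k ε E), lowerBoxDim E) ∧
    dimAvoid k ε =
      (⨆ (E : Set ℝ) (_ : Bornology.IsBounded E ∧ AvoidsAPs k ε E), upperBoxDim E) ∧
    dimAvoid k ε =
      (⨆ (E : Set ℝ) (_ : Bornology.IsBounded E ∧ AvoidsAPs k ε E), packingDim E) ∧
    ∃ E : Set ℝ, IsCompact E ∧ (ε < 1 → E.Nonempty) ∧ AvoidsAPs k ε E ∧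
      dimH E = dimAvoid k ε ∧ assouadDim E = dimAvoid k ε ∧
      lowerBoxDim E = dimAvoid k ε ∧ upperBoxDim E = dimAvoid k ε ∧
      packingDim E = dimAvoid k ε := by
  have hH : ∀ E : Set ℝ, Bornology.IsBounded E ∧ AvoidsAPs k ε E → dimH E ≤ dimAvoid k ε :=
    fun E hE => le_iSup₂_of_le E hE le_rfl
  have hA : ∀ E : Set ℝ, Bornology.IsBounded E ∧ AvoidsAPs k ε E →
      assouadDim E ≤ dimAvoid k ε := fun E hE => hE.2.assouadDim_le hε
  have hU : ∀ E : Set ℝ, Bornology.IsBounded E ∧ AvoidsAPs k ε E →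
      upperBoxDim E ≤ dimAvoid k ε := fun E hE =>
    (upperBoxDim_le_assouadDim hE.1).trans (hA E hE)
  have hL : ∀ E : Set ℝ, Bornology.IsBounded E ∧ AvoidsAPs k ε E →
      lowerBoxDim E ≤ dimAvoid k ε := fun E hE =>
    (lowerBoxDim_le_upperBoxDim E).trans (hU E hE)
  have hP : ∀ E : Set ℝ, Bornology.IsBounded E ∧ AvoidsAPs k ε E →
      packingDim E ≤ dimAvoid k ε := fun E hE =>
    (packingDim_le_upperBoxDim hE.1).trans (hU E hE)
  have hHU : ∀ E : Set ℝ, dimH E ≤ upperBoxDim E := fun E =>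
    (dimH_le_lowerBoxDim E).trans (lowerBoxDim_le_upperBoxDim E)
  have hHA : ∀ E : Set ℝ, Bornology.IsBounded E → dimH E ≤ assouadDim E := fun E hE =>
    (hHU E).trans (upperBoxDim_le_assouadDim hE)
  refine ⟨le_antisymm ?_ ?_, le_antisymm ?_ (iSup₂_le hA), le_antisymm ?_ (iSup₂_le hL),
    le_antisymm ?_ (iSup₂_le hU), le_antisymm ?_ (iSup₂_le hP), ?_⟩
  · exact iSup₂_le fun E hE => le_iSup₂_of_le E hE.2 le_rfl
  · refine iSup₂_le fun E hE => ?_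
    -- Countable stability of `dimH` reduces unbounded sets to bounded pieces.
    have hcov : E = ⋃ n : ℕ, E ∩ Metric.ball 0 n := by
      rw [← inter_iUnion, Metric.iUnion_ball_nat, inter_univ]
    rw [hcov, dimH_iUnion]
    exact iSup_le fun n => hH _
      ⟨Metric.isBounded_ball.subset inter_subset_right, hE.mono inter_subset_left⟩
  · exact iSup₂_mono fun E hE => hHA E hE.1
  · exact iSup₂_mono fun E _ => dimH_le_lowerBoxDim E
  · exact iSup₂_mono fun E _ => hHU E
  · exact iSup₂_mono fun E _ => dimH_le_packingDim E
  · obtain ⟨K, hK, hne, hKa, hd⟩ := exists_isCompact_dimAvoid_le_dimH hk hε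
    have hb : Bornology.IsBounded K ∧ AvoidsAPs k ε K := ⟨hK.isBounded, hKa⟩
    exact ⟨K, hK, hne, hKa, le_antisymm (hH K hb) hd,
      le_antisymm (hA K hb) (hd.trans (hHA K hb.1)),
      le_antisymm (hL K hb) (hd.trans (dimH_le_lowerBoxDim K)),
      le_antisymm (hU K hb) (hd.trans (hHU K)),
      le_antisymm (hP K hb) (hd.trans (dimH_le_packingDim K))⟩
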